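/- Definitions. A $T\times K$ complex orthogonal design (COD) in $k$ complex variables is a $T\times K$ matrix $\mathbf X$ with entries from $\{0,\pm x_i,\pm x_i^*\}$ such that $\mathbf X^H\mathbf X=(|x_1|^2+\dots+|x_k|^2)\mathbf I_K$; its rate is $k/T$, and it is a maximal-rate COD if no COD with $K$ columns (and any number of rows and variables) has a larger rate. Replacing the zeros of $\mathbf X$ by a constant $\alpha\neq 0$ gives the training-embedded design (TE-COD) of $\mathbf X$. A training-embedded distributed space-time block code (TE-DSTBC) for $K$ relays, with $k\le T$ complex information symbols $x_1,\dots,x_k$, is given by a training symbol $\alpha\ne0$, a complex signal set and relay matrices $\mathbf A_\lambda,\mathbf B_\lambda\in\mathbb C^{T\times T}$, $1\le\lambda\le K$. In the first phase the source broadcasts $[\alpha\cdots\alpha\;x_1\cdots x_k]^T$ with $\lceil\frac{T-k}2\rceil$ copies of $\alpha$, one entry per channel use; in the second phase, of $T$ channel uses, the relays generate the $T\times K$ codeword whose $\lambda$-th column is $\mathbf A_\lambda\bar{\mathbf x}+\mathbf B_\lambda\bar{\mathbf x}^*$, where $\bar{\mathbf x}=[\alpha\cdots\alpha\;x_1\cdots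 x_k]^T$ contains $T-k$ copies of $\alpha$. Its overall rate is $k$ divided by the total number of channel uses of both phases. It is generated by a COD $\mathbf X$ if its codeword equals the TE-COD of $\mathbf X$ for all values of $x_1,\dots,x_k$. Statement. (1) The overall rate of a TE-DSTBC is $$\frac{k}{\lceil\frac{T-k}{2}\rceil+k+T}.$$ (2) Every COD with $K\ge1$ columns generates, for every $\alpha\ne0$ and every signal set, a TE-DSTBC; and maximal-rate CODs exist for every $K\ge 1$. (3) Let $m\ge1$ and $K\in\{2m,2m-1\}$. A TE-DSTBC generated by a maximal-rate COD with $K$ columns and $T$ rows has overall rate $$\frac{\frac{T(m+1)}{2m}}{\frac{T(m+1)}{2m}+T+\left\lceil T\left(\frac14-\frac1{4m}\right)\right\rceil}.$$ (4) There are maximal-rate CODs with $(K,T,k)=(4,4,3)$, $(5,15,10)$, $(6,30,20)$, $(7,56,35)$, $(8,112,70)$, $(9,210,126)$, $(10,420,252)$, and the TE-DSTBCs generated by maximal-rate CODs with these parameters have the overall rates $$\frac38,\quad\frac5{14},\quad\frac4{11},\quad\frac{35}{102},\quad\frac{70}{203},\quad\frac{126}{378}=\frac13,\quad\frac{252}{756}=\frac13,$$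 respectively. (5) The earlier single-symbol decodable DSTBCs, of rate $k/T=\frac12$ in the second phase, have overall rate $k/(k+T)=\frac13$ if the first phase is counted with $k$ channel uses, that is, without training. For every $K\ge1$, a TE-DSTBC generated by a maximal-rate COD with $K$ columns has overall rate greater than $\frac13$ if and only if $K<9$, equal to $\frac13$ if and only if $K\in\{9,10\}$, and smaller than $\frac13$ if and only if $K\ge11$. -/

import Mathlib

open scoped Matrix

namespace TECOD

/-! ### Complex orthogonal designs -/

/-- An entry of a complex design in the variables `x₁, …, x_k`: either `0`, or one of
`x_i`, `-x_i`, `x_i^*`, `-x_i^*`. -/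
inductive Entry (k : ℕ) : Type
  | zero : Entry k
  | var (sign : ℤˣ) (i : Fin k) : Entry k
  | conjVar (sign : ℤˣ) (i : Fin k) : Entry k

/-- The value of an entry when the variables take the values `x` and the zero entry is
replaced by the constant `α` (so `α = 0` gives the value of the entry itself). -/
noncomputable def Entry.eval {k : ℕ} (α : ℂ) (x : Fin k → ℂ) : Entry k → ℂ
  | .zero => α
  | .var s i => ((s : ℤ) : ℂ) * x i
  | .conjVar s i => ((s : ℤ) : ℂ) * star (x i)

/-- A `T × K` complex design in `k` variables, as a matrix of formal entries. -/
abbrev Design (T K k : ℕ) : Type := Matrix (Fin T) (Fin K) (Entry k)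

/-- The complex matrix obtained from a design by inserting values for the variables. -/
noncomputable def Design.eval {T K k : ℕ} (X : Design T K k) (x : Fin k → ℂ) :
    Matrix (Fin T) (Fin K) ℂ :=
  X.map (Entry.eval 0 x)

/-- The training-embedded version of a design: all zeros are replaced by the constant `α`. -/
noncomputable def Design.teEval {T K k : ℕ} (X : Design T K k) (α : ℂ) (x : Fin k → ℂ) :
    Matrix (Fin T) (Fin K) ℂ :=
  X.map (Entry.eval α x)

/-- `X` is a complex orthogonal design (COD): `Xᴴ X = (|x₁|² + ⋯ + |x_k|²) I_K`. -/
def Design.IsCOD {T K k : ℕ} (X : Design T K k) : Prop :=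
  ∀ x : Fin k → ℂ, (X.eval x)ᴴ * X.eval x =
    ((∑ i, ‖x i‖ ^ 2 : ℝ) : ℂ) • (1 : Matrix (Fin K) (Fin K) ℂ)

/-- `X` is a COD whose rate `k / T` is the largest one among all CODs with the same number `K`
of columns (and any numbers of rows and variables). -/
def Design.IsMaximalRateCOD {T K k : ℕ} (X : Design T K k) : Prop :=
  X.IsCOD ∧ ∀ (T' k' : ℕ) (Y : Design T' K k'), Y.IsCOD → (k' : ℚ) / T' ≤ (k : ℚ) / T

/-! ### Training-embedded distributed space-time block codes -/

/-- The number `N = ⌈(T - k) / 2⌉ + k` of channel uses in the first phase: `⌈(T - k) / 2⌉`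
training symbols followed by the `k` information symbols. -/
def firstPhaseUses (T k : ℕ) : ℕ := ⌈((T : ℚ) - k) / 2⌉₊ + k

/-- The data determining a training-embedded distributed space-time block code for `K` relays,
with `k` information symbols and `T` channel uses in the second phase: the nonzero training
symbol `α`, the complex signal set, and the relay matrices `A_λ`, `B_λ`. -/
structure TEDSTBC (T K k : ℕ) where
  k_le : k ≤ T
  alpha : ℂ
  alpha_ne_zero : alpha ≠ 0
  signalSet : Set ℂ
  A : Fin K → Matrix (Fin T) (Fin T) ℂ
  B : Fin K → Matrix (Fin T) (Fin T) ℂ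

namespace TEDSTBC

variable {T K k : ℕ}

/-- The vector `[α ⋯ α x₁ ⋯ x_k]` of length `N` broadcast by the source in the first phase. -/
def sourceVector (C : TEDSTBC T K k) (x : Fin k → ℂ) : Fin (firstPhaseUses T k) → ℂ :=
  Fin.append (fun _ => C.alpha) x

/-- The codebook of the source: all source vectors with symbols from the signal set. -/
def sourceCodebook (C : TEDSTBC T K k) : Set (Fin (firstPhaseUses T k) → ℂ) :=
  C.sourceVector '' {x | ∀ i, x i ∈ C.signalSet}

/-- The vector `x̄ = [α ⋯ α x₁ ⋯ x_k]` of length `T`, with `T - k` copies of `α`. -/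
def extendedVector (C : TEDSTBC T K k) (x : Fin k → ℂ) : Fin T → ℂ := fun t =>
  Fin.append (fun _ : Fin (T - k) => C.alpha) x (t.cast (Nat.sub_add_cancel C.k_le).symm)

/-- The `T × K` codeword, whose `λ`-th column is `A_λ x̄ + B_λ x̄^*`; its rows correspond to the
channel uses of the second phase, its columns to the relays. -/
noncomputable def codeword (C : TEDSTBC T K k) (x : Fin k → ℂ) : Matrix (Fin T) (Fin K) ℂ :=
  Matrix.of fun t l =>
    (C.A l *ᵥ C.extendedVector x + C.B l *ᵥ star (C.extendedVector x)) t

/-- The collection of codewords. -/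
def code (C : TEDSTBC T K k) : Set (Matrix (Fin T) (Fin K) ℂ) :=
  C.codeword '' {x | ∀ i, x i ∈ C.signalSet}

/-- The number of channel uses in the first phase (the length of the source vectors) plus the
number of channel uses in the second phase (the number of rows of the codewords). -/
def channelUses (_C : TEDSTBC T K k) : ℕ :=
  Fintype.card (Fin (firstPhaseUses T k)) + Fintype.card (Fin T)

/-- The overall rate, in complex information symbols per channel use, both phases counted. -/
def overallRate (C : TEDSTBC T K k) : ℚ := (k : ℚ) / C.channelUses

/-- The code consists of the values of the TE-COD obtained from the design `X`, that is, its
relay matrices are column-vector representation matrices of that TE-COD. -/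
def IsGeneratedBy (C : TEDSTBC T K k) (X : Design T K k) : Prop :=
  ∀ x : Fin k → ℂ, C.codeword x = X.teEval C.alpha x

end TEDSTBC

/-- The overall rate of a two-phase scheme whose training is not counted: `k` symbols are sent
in `k` channel uses of the first phase and `T` channel uses of the second phase. -/
def overallRateWithoutTraining (T k : ℕ) : ℚ := (k : ℚ) / ((k : ℚ) + T)

/-- There is a maximal-rate COD for `K` relays with `T` rows and `k` variables, and every TE-DSTBC
generated by such a COD has overall rate `r`. -/
def TableEntry (K T k : ℕ) (r : ℚ) : Prop :=
  (∃ X : Design T K k, X.IsMaximalRateCOD) ∧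
    ∀ (X : Design T K k) (C : TEDSTBC T K k),
      X.IsMaximalRateCOD → C.IsGeneratedBy X → C.overallRate = r

end TECOD

/-! The core is that maximal-rate CODs with 2m or 2m - 1 columns have rate exactly (m + 1)/(2m);
most of the remaining claims then reduce to arithmetic.

Upper bound (`IsCOD.rate_bound`): every variable occurs once in each column and at most once in each
row. If x_i occurs in columns a and b with the same conjugation status, its row in column a has a
zero in column b (`IsCOD.eq_zero_of_isConj_eq`). Let w_t be the number of nonzero entries of row t.
Then ∑ w_t = kK, and a variable conjugated in p columns and unconjugated in q contributes at most K
+ 2pq to ∑ w_t². Summing (w_t - m)(w_t - m - 1) ≥ 0 over the rows yields the bound.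

Attainment (`exists_subsetDesign`): variables are the m-subsets of the columns, rows the subsets S
of size m - 1 or m + 1, and entry (S, j) is ± the variable of S ∆ {j}, or zero if that set has the
wrong size, conjugated when j ∈ S. Rows S and S ∆ {i, j} cancel in the inner product of columns i
and j.

In the comparison with 1/3 the ceiling matters: (T, k) = (3, 2) and (8, 5) satisfy the rate equation
for m = 3 and m = 4 but would give exactly 1/3. They are excluded by `IsCOD.columns_le` and
`not_isCOD_of_seven_columns`. -/

namespace TECOD

/-! ### The variables in the columns and rows of a complex orthogonal design -/

/-- The index of the variable of an entry, if the entry is nonzero. -/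
def Entry.index {k : ℕ} : Entry k → Option (Fin k)
  | .zero => none
  | .var _ i => some i
  | .conjVar _ i => some i

/-- Whether an entry is a conjugated variable. -/
def Entry.isConj {k : ℕ} : Entry k → Bool
  | .zero => false
  | .var _ _ => false
  | .conjVar _ _ => true

theorem Entry.index_eq_none {k : ℕ} {e : Entry k} : e.index = none ↔ e = .zero := by
  cases e <;> simp [Entry.index]

theorem Entry.eval_eq_zero {k : ℕ} {e : Entry k} {x : Fin k → ℂ}
    (h : ∀ i, e.index = some i → x i = 0) : e.eval 0 x = 0 := by
  cases e with
  | zero => rfl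
  | var s i => simp [Entry.eval, h i rfl]
  | conjVar s i => simp [Entry.eval, h i rfl]

theorem Entry.exists_eval_eq {k : ℕ} {e : Entry k} {i : Fin k} (h : e.index = some i) :
    ∃ s : ℤˣ, ∀ x : Fin k → ℂ,
      e.eval 0 x = ((s : ℤ) : ℂ) * (if e.isConj then star (x i) else x i) := by
  cases e with
  | zero => simp [Entry.index] at h
  | var s j =>
    simp only [Entry.index, Option.some.injEq] at h
    exact ⟨s, fun x => by simp [Entry.eval, Entry.isConj, h]⟩
  | conjVar s j =>
    simp only [Entry.index, Option.some.injEq] at h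
    exact ⟨s, fun x => by simp [Entry.eval, Entry.isConj, h]⟩

theorem units_int_cast_ne_zero (s : ℤˣ) : ((s : ℤ) : ℂ) ≠ 0 := by
  rcases Int.units_eq_one_or s with rfl | rfl <;> simp

theorem Entry.eval_ne_zero {k : ℕ} {e : Entry k} {i : Fin k} {x : Fin k → ℂ}
    (h : e.index = some i) (hx : x i ≠ 0) : e.eval 0 x ≠ 0 := by
  obtain ⟨s, hs⟩ := Entry.exists_eval_eq h
  rw [hs]
  refine mul_ne_zero (units_int_cast_ne_zero s) ?_
  split_ifs
  · simpa using hx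
  · exact hx

theorem Entry.normSq_eval_single {k : ℕ} (e : Entry k) (i : Fin k) :
    star (e.eval 0 (Pi.single i 1)) * e.eval 0 (Pi.single i 1) =
      if e.index = some i then 1 else 0 := by
  split_ifs with h
  · obtain ⟨s, hs⟩ := Entry.exists_eval_eq h
    rw [hs]
    rcases Int.units_eq_one_or s with rfl | rfl <;> simp
  · rw [Entry.eval_eq_zero, mul_zero]
    intro j hj
    exact Pi.single_eq_of_ne (fun hji : j = i => h (hji ▸ hj)) _

namespace Design

variable {T K k : ℕ} {X : Design T K k}

theorem isCOD_iff : X.IsCOD ↔ ∀ (x : Fin k → ℂ) (a b : Fin K),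
    ∑ t, star ((X t a).eval 0 x) * (X t b).eval 0 x =
      if a = b then ((∑ i, ‖x i‖ ^ 2 : ℝ) : ℂ) else 0 := by
  refine forall_congr' fun x => ?_
  rw [← Matrix.ext_iff]
  refine forall₂_congr fun a b => ?_
  simp [Matrix.mul_apply, Design.eval, Matrix.one_apply]

/-- At the i-th unit vector, the squared norm of column a counts the occurrences of x_i in it. -/
theorem IsCOD.existsUnique_row (h : X.IsCOD) (i : Fin k) (a : Fin K) :
    ∃! t, (X t a).index = some i := by
  have h1 := isCOD_iff.1 h (Pi.single i 1) a a
  simp only [Entry.normSq_eval_single, if_true, Finset.sum_boole] at h1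
  have h2 : ∑ j, ‖(Pi.single i (1 : ℂ) : Fin k → ℂ) j‖ ^ 2 = 1 := by
    rw [Finset.sum_eq_single i]
    · simp
    · intro j _ hj
      simp [Pi.single_eq_of_ne hj]
    · simp
  rw [h2] at h1
  have h3 : (Finset.univ.filter fun t => (X t a).index = some i).card = 1 := by
    exact_mod_cast h1
  obtain ⟨t, ht⟩ := Finset.card_eq_one.1 h3
  have h4 : ∀ s, (X s a).index = some i ↔ s = t := fun s => by
    simpa using Finset.ext_iff.1 ht s
  exact ⟨t, (h4 t).2 rfl, fun s hs => (h4 s).1 hs⟩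

/-- A variable occurs at most once in every row. -/
theorem IsCOD.col_unique (h : X.IsCOD) {t : Fin T} {a b : Fin K} {i : Fin k}
    (ha : (X t a).index = some i) (hb : (X t b).index = some i) : a = b := by
  by_contra hab
  -- At the i-th unit vector, row t alone contributes to the inner product of the two columns, and
  -- its term is nonzero.
  have h1 := isCOD_iff.1 h (Pi.single i 1) a b
  rw [if_neg hab, Finset.sum_eq_single t] at h1
  · exact mul_ne_zero (star_ne_zero.2 (Entry.eval_ne_zero ha (by simp)))
      (Entry.eval_ne_zero hb (by simp)) h1
  · intro s _ hs
    rw [Entry.eval_eq_zero (e := X s a), star_zero, zero_mul]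
    intro j hj
    refine Pi.single_eq_of_ne (fun hji => hs ?_) _
    exact (h.existsUnique_row i a).unique (hji ▸ hj) ha
  · simp

/-- If a variable occurs in columns `a` and `b`, conjugated in both or in none, then the row of
its occurrence in column `a` has a zero in column `b`. -/
theorem IsCOD.eq_zero_of_isConj_eq (h : X.IsCOD) {r s : Fin T} {a b : Fin K} {i : Fin k}
    (hab : a ≠ b) (ha : (X r a).index = some i) (hb : (X s b).index = some i)
    (hc : (X r a).isConj = (X s b).isConj) : X r b = .zero := by
  rw [← Entry.index_eq_none, Option.eq_none_iff_forall_not_mem]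
  intro j hj
  change (X r b).index = some j at hj
  have hji : j ≠ i := fun hji => hab (h.col_unique ha (hji ▸ hj))
  have hrs : r ≠ s := fun hrs => hji (by
    rw [hrs, hb] at hj
    exact (Option.some.inj hj).symm)
  -- With x_i = z, x_j = 1 and all else zero, only rows r and s contribute to the inner product of
  -- columns a and b. Equal conjugation status makes one term a multiple of z and the other a
  -- multiple of its conjugate, so the sum cannot vanish at both z = 1 and z = I.
  let x : ℂ → Fin k → ℂ := fun z l => if l = i then z else if l = j then 1 else 0
  have hxi : ∀ z, x z i = z := fun z => by simp [x]
  have hxj : ∀ z, x z j = 1 := fun z => by simp [x, hji]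
  have hx : ∀ z l, l ≠ i → l ≠ j → x z l = 0 := fun z l h1 h2 => by simp [x, h1, h2]
  have key : ∀ z, star ((X r a).eval 0 (x z)) * (X r b).eval 0 (x z) +
      star ((X s a).eval 0 (x z)) * (X s b).eval 0 (x z) = 0 := by
    intro z
    have h1 := isCOD_iff.1 h (x z) a b
    rw [if_neg hab] at h1
    rw [← Finset.sum_pair hrs (f := fun t =>
      star ((X t a).eval 0 (x z)) * (X t b).eval 0 (x z))]
    refine Eq.trans ?_ h1
    refine Finset.sum_subset (Finset.subset_univ _) fun t _ ht => ?_
    simp only [Finset.mem_insert, Finset.mem_singleton, not_or] at ht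
    by_cases htj : (X t a).index = some j
    · rw [Entry.eval_eq_zero (e := X t b), mul_zero]
      intro l hl
      refine hx z l (fun hli => ht.2 ?_) (fun hlj => hab ?_)
      · exact (h.existsUnique_row i b).unique (hli ▸ hl) hb
      · exact h.col_unique htj (hlj ▸ hl)
    · rw [Entry.eval_eq_zero (e := X t a), star_zero, zero_mul]
      intro l hl
      refine hx z l (fun hli => ht.1 ?_) (fun hlj => htj (hlj ▸ hl))
      exact (h.existsUnique_row i a).unique (hli ▸ hl) ha
  have hconst : (X s a).eval 0 (x Complex.I) = (X s a).eval 0 (x 1) := by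
    have : ∀ l, (X s a).index = some l → x Complex.I l = x 1 l := by
      intro l hl
      have hli : l ≠ i := fun hli => hab (h.col_unique (hli ▸ hl) hb)
      simp [x, hli]
    revert this
    cases X s a <;> simp +contextual [Entry.eval, Entry.index]
  obtain ⟨s₁, h₁⟩ := Entry.exists_eval_eq ha
  obtain ⟨s₂, h₂⟩ := Entry.exists_eval_eq hj
  obtain ⟨s₃, h₃⟩ := Entry.exists_eval_eq hb
  have k1 := key 1
  have k2 := key Complex.I
  rw [hconst] at k2
  simp only [h₁, h₂, h₃, ← hc, hxi, hxj, star_one, ite_self, mul_one] at k1 k2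
  have hn := mul_ne_zero (units_int_cast_ne_zero s₁) (units_int_cast_ne_zero s₂)
  have hI : (2 : ℂ) * Complex.I ≠ 0 := by simp
  refine mul_ne_zero hI hn ?_
  cases hcc : (X r a).isConj <;> simp [hcc] at k1 k2
  · linear_combination Complex.I * k1 - k2
  · linear_combination Complex.I * k1 + k2

/-- The row of the occurrence of the variable `i` in the column `a`. -/
noncomputable def row (h : X.IsCOD) (i : Fin k) (a : Fin K) : Fin T :=
  (h.existsUnique_row i a).choose

theorem index_row (h : X.IsCOD) (i : Fin k) (a : Fin K) : (X (row h i a) a).index = some i :=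
  (h.existsUnique_row i a).choose_spec.1

theorem index_eq_some_iff (h : X.IsCOD) {t : Fin T} {a : Fin K} {i : Fin k} :
    (X t a).index = some i ↔ t = row h i a :=
  ⟨fun ht => (h.existsUnique_row i a).unique ht (index_row h i a),
    fun ht => ht ▸ index_row h i a⟩

theorem row_injective (h : X.IsCOD) (a : Fin K) : Function.Injective fun i => row h i a := by
  intro i j hij
  have := index_row h j a
  rw [← show row h i a = row h j a from hij, index_row h i a] at this
  exact Option.some.inj this

theorem IsCOD.card_variables_le (h : X.IsCOD) (hK : 1 ≤ K) : k ≤ T := by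
  simpa using Fintype.card_le_of_injective _ (row_injective h ⟨0, hK⟩)

/-- The columns of the nonzero entries of a row. -/
def rowSupport (X : Design T K k) (t : Fin T) : Finset (Fin K) :=
  Finset.univ.filter fun a => (X t a).index ≠ none

theorem mem_rowSupport {t : Fin T} {a : Fin K} :
    a ∈ X.rowSupport t ↔ (X t a).index ≠ none := by
  simp [rowSupport]

/-- Double counting: nonzero positions (t, a) correspond to pairs (i, a) through `row`. Weight 1
gives ∑ w_t, weight w gives ∑ w_t². -/
theorem sum_card_rowSupport_mul (h : X.IsCOD) (f : Fin T → ℤ) :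
    ∑ t, ((X.rowSupport t).card : ℤ) * f t = ∑ i, ∑ a, f (row h i a) := by
  have h1 : ∀ t a, (if (X t a).index ≠ none then f t else 0) =
      ∑ i, if t = row h i a then f t else 0 := by
    intro t a
    simp only [← index_eq_some_iff h]
    cases (X t a).index with
    | none => simp
    | some j => simp
  have h2 : ∀ t, ((X.rowSupport t).card : ℤ) * f t =
      ∑ a, if (X t a).index ≠ none then f t else 0 := by
    intro t
    rw [← Finset.sum_filter, Finset.sum_const, nsmul_eq_mul, rowSupport]
  simp only [h2, h1]
  rw [Finset.sum_comm, Finset.sum_comm (f := fun i a => f (row h i a))]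
  refine Finset.sum_congr rfl fun a _ => ?_
  rw [Finset.sum_comm]
  refine Finset.sum_congr rfl fun i _ => ?_
  simp

theorem sum_card_rowSupport (h : X.IsCOD) : ∑ t, ((X.rowSupport t).card : ℤ) = k * K := by
  simpa using sum_card_rowSupport_mul h 1

theorem card_rowSupport_le (h : X.IsCOD) (t : Fin T) : (X.rowSupport t).card ≤ k := by
  have h1 : ∀ a : X.rowSupport t, ∃ i, (X t a).index = some i := fun a =>
    Option.ne_none_iff_exists'.1 (mem_rowSupport.1 a.2)
  choose g hg using h1
  have h2 : Function.Injective g := fun a b hab =>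
    Subtype.ext (h.col_unique (hg a) (hab ▸ hg b))
  simpa using Fintype.card_le_of_injective g h2

/-- Whether the variable `i` is conjugated in the column `a`. -/
noncomputable def conjugated (h : X.IsCOD) (i : Fin k) (a : Fin K) : Bool :=
  (X (row h i a) a).isConj

/-- The number of columns in which the variable `i` occurs with conjugation status `c`. -/
noncomputable def columnCount (h : X.IsCOD) (i : Fin k) (c : Bool) : ℕ :=
  (Finset.univ.filter fun a => conjugated h i a = c).card

theorem columnCount_add (h : X.IsCOD) (i : Fin k) (c : Bool) :
    columnCount h i c + columnCount h i (!c) = K := by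
  have := Finset.card_filter_add_card_filter_not (s := (Finset.univ : Finset (Fin K)))
    (fun a => conjugated h i a = c)
  rw [Finset.card_univ, Fintype.card_fin] at this
  simpa only [columnCount, Bool.eq_not] using this

/-- In any other column where this row is nonzero, x_i must have the opposite conjugation status. -/
theorem card_rowSupport_row_le (h : X.IsCOD) (i : Fin k) (a : Fin K) :
    (X.rowSupport (row h i a)).card ≤ columnCount h i (!conjugated h i a) + 1 := by
  refine le_trans (Finset.card_le_card fun b hb => ?_) (Finset.card_insert_le a _)
  rw [Finset.mem_insert, Finset.mem_filter]
  by_contra! hcon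
  refine mem_rowSupport.1 hb (Entry.index_eq_none.2 ?_)
  refine h.eq_zero_of_isConj_eq hcon.1.symm (index_row h i a) (index_row h i b) ?_
  have := hcon.2 (Finset.mem_univ _)
  rw [Ne, Bool.eq_not, not_not] at this
  exact this.symm

theorem sum_card_rowSupport_row_le (h : X.IsCOD) (i : Fin k) :
    ∑ a, ((X.rowSupport (row h i a)).card : ℤ) ≤
      K + 2 * columnCount h i true * columnCount h i false := by
  have h1 : ∑ a, (X.rowSupport (row h i a)).card ≤
      ∑ a, (columnCount h i (!conjugated h i a) + 1) :=
    Finset.sum_le_sum fun a _ => card_rowSupport_row_le h i a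
  have h2 : ∑ a, columnCount h i (!conjugated h i a) =
      columnCount h i true * columnCount h i false +
        columnCount h i false * columnCount h i true := by
    have h3 : ∀ a, columnCount h i (!conjugated h i a) =
        (if conjugated h i a = true then columnCount h i false else 0) +
          if conjugated h i a = false then columnCount h i true else 0 := by
      intro a
      cases conjugated h i a <;> simp
    rw [Finset.sum_congr rfl fun a _ => h3 a, Finset.sum_add_distrib, ← Finset.sum_filter,
      ← Finset.sum_filter, Finset.sum_const, Finset.sum_const, smul_eq_mul, smul_eq_mul]
    rfl
  rw [Finset.sum_add_distrib, h2] at h1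
  simp only [Finset.sum_const, Finset.card_univ, Fintype.card_fin, smul_eq_mul, mul_one] at h1
  zify at h1
  linarith

/-- The upper bound `(m + 1) / (2 m)` for the rate of a COD with `2 m - 1` or `2 m` columns. -/
theorem IsCOD.rate_bound (h : X.IsCOD) {m : ℕ} (hm : 1 ≤ m) (hK : K = 2 * m ∨ K = 2 * m - 1) :
    2 * m * k ≤ (m + 1) * T := by
  -- No integer lies strictly between m and m + 1.
  have h0 : (0 : ℤ) ≤ ∑ t, (((X.rowSupport t).card : ℤ) - m) *
      (((X.rowSupport t).card : ℤ) - (m + 1)) := by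
    refine Finset.sum_nonneg fun t _ => ?_
    rcases le_or_gt ((X.rowSupport t).card : ℤ) m with hw | hw
    · exact mul_nonneg_of_nonpos_of_nonpos (by linarith) (by linarith)
    · exact mul_nonneg (by linarith) (by linarith)
  have h1 : ∑ t, (((X.rowSupport t).card : ℤ) - m) * (((X.rowSupport t).card : ℤ) - (m + 1)) =
      ∑ t, ((X.rowSupport t).card : ℤ) * (X.rowSupport t).card -
        (2 * m + 1) * ∑ t, ((X.rowSupport t).card : ℤ) + m * (m + 1) * T := by
    have : (m * (m + 1) * T : ℤ) = ∑ _t : Fin T, (m * (m + 1) : ℤ) := by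
      simp [mul_comm]
    rw [this, Finset.mul_sum, ← Finset.sum_sub_distrib, ← Finset.sum_add_distrib]
    exact Finset.sum_congr rfl fun t _ => by ring
  rw [h1, sum_card_rowSupport h, sum_card_rowSupport_mul h] at h0
  -- Since p + q = K, the product pq is at most m² for K = 2m and m(m - 1) for K = 2m - 1; in both
  -- cases K + 2pq is then bounded by this expression.
  have h2 : ∀ i, ∑ a, ((X.rowSupport (row h i a)).card : ℤ) ≤ (2 * m + 1) * K - 2 * m ^ 2 := by
    intro i
    refine (sum_card_rowSupport_row_le h i).trans ?_
    have h3 := columnCount_add h i true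
    rw [Bool.not_true] at h3
    generalize columnCount h i true = p at h3 ⊢
    generalize columnCount h i false = q at h3 ⊢
    rcases hK with hK | hK
    · have h4 : (q : ℤ) = 2 * m - p := by omega
      have h5 : (K : ℤ) = 2 * m := by omega
      rw [h4, h5]
      nlinarith [sq_nonneg ((p : ℤ) - m)]
    · have h4 : (q : ℤ) = 2 * m - 1 - p := by omega
      have h5 : (K : ℤ) = 2 * m - 1 := by omega
      rw [h4, h5]
      have : (0 : ℤ) ≤ (p - m) * (p - (m - 1)) := by
        rcases le_or_gt (m : ℤ) p with hp | hp
        · exact mul_nonneg (by linarith) (by linarith)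
        · exact mul_nonneg_of_nonpos_of_nonpos (by linarith) (by linarith [Int.add_one_le_iff.2 hp])
      nlinarith
  have h6 := Finset.sum_le_sum fun i (_ : i ∈ Finset.univ) => h2 i
  rw [Finset.sum_const, Finset.card_univ, Fintype.card_fin, nsmul_eq_mul] at h6
  have h7 : (m : ℤ) * (2 * m * k) ≤ m * ((m + 1) * T) := by nlinarith
  exact_mod_cast le_of_mul_le_mul_left h7 (by exact_mod_cast hm)

theorem IsCOD.submatrix (h : X.IsCOD) {K' : ℕ} {f : Fin K' → Fin K} (hf : Function.Injective f) :
    Design.IsCOD (Matrix.submatrix X id f : Design T K' k) := by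
  rw [isCOD_iff] at h ⊢
  intro x a b
  simpa [hf.eq_iff] using h x (f a) (f b)

theorem IsCOD.columns_le (h : X.IsCOD) (hk : 1 ≤ k) : K ≤ T := by
  have h1 : ∑ t, (X.rowSupport t).card ≤ ∑ _t : Fin T, k :=
    Finset.sum_le_sum fun t _ => card_rowSupport_le h t
  have h2 := sum_card_rowSupport h
  norm_cast at h2
  rw [h2, Finset.sum_const, Finset.card_univ, Fintype.card_fin, smul_eq_mul] at h1
  exact le_of_mul_le_mul_left (by rwa [mul_comm T k] at h1) hk

/-- These parameters meet the rate bound with equality, so a finer argument is needed: two rows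
containing all five variables must exist, and the conjugation counts of one variable rule them out.
-/
theorem not_isCOD_of_seven_columns (X : Design 8 7 5) : ¬ X.IsCOD := by
  intro h
  have hsum := sum_card_rowSupport h
  norm_cast at hsum
  obtain ⟨r, s, hrs, hr, hs⟩ : ∃ r s, r ≠ s ∧ 5 ≤ (X.rowSupport r).card ∧
      5 ≤ (X.rowSupport s).card := by
    -- There are 35 nonzero entries, but a single row of weight 5 allows at most 5 + 7 · 4 = 33.
    by_contra! hcon
    have hle : ∃ r, ∀ t, t ≠ r → (X.rowSupport t).card ≤ 4 := by
      by_cases hex : ∃ r, 5 ≤ (X.rowSupport r).card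
      · obtain ⟨r, hr⟩ := hex
        exact ⟨r, fun t ht => Nat.le_of_lt_succ (hcon r t ht.symm hr)⟩
      · push Not at hex
        exact ⟨0, fun t _ => Nat.le_of_lt_succ (hex t)⟩
    obtain ⟨r, hr⟩ := hle
    have h1 : ∑ t ∈ Finset.univ.erase r, (X.rowSupport t).card ≤
        ∑ t ∈ Finset.univ.erase r, 4 :=
      Finset.sum_le_sum fun t ht => hr t (Finset.ne_of_mem_erase ht)
    have h2 := Finset.sum_erase_add Finset.univ (fun t => (X.rowSupport t).card)
      (Finset.mem_univ r)
    have h3 := card_rowSupport_le h r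
    simp at h1
    omega
  obtain ⟨b, hb⟩ : (X.rowSupport r ∩ X.rowSupport s).Nonempty := by
    rw [← Finset.card_pos]
    have h1 := Finset.card_union_add_card_inter (X.rowSupport r) (X.rowSupport s)
    have h2 := Finset.card_le_univ (X.rowSupport r ∪ X.rowSupport s)
    rw [Fintype.card_fin] at h2
    omega
  obtain ⟨hbr, hbs⟩ := Finset.mem_inter.1 hb
  obtain ⟨i, hi⟩ := Option.ne_none_iff_exists'.1 (mem_rowSupport.1 hbs)
  -- Row r has five entries with distinct variables, hence contains every variable.
  obtain ⟨a, ha⟩ : ∃ a, (X r a).index = some i := by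
    have h1 : ∀ a : X.rowSupport r, ∃ i, (X r a).index = some i := fun a =>
      Option.ne_none_iff_exists'.1 (mem_rowSupport.1 a.2)
    choose g hg using h1
    have h2 : Function.Injective g := fun a b hab =>
      Subtype.ext (h.col_unique (hg a) (hab ▸ hg b))
    have h3 : Function.Bijective g := by
      rw [Fintype.bijective_iff_injective_and_card]
      exact ⟨h2, by simpa using le_antisymm (card_rowSupport_le h r) hr⟩
    obtain ⟨a, ha⟩ := h3.2 i
    exact ⟨a, ha ▸ hg a⟩
  have hab : a ≠ b := fun hab =>
    hrs ((h.existsUnique_row i b).unique (hab ▸ ha) hi)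
  have hra := (index_eq_some_iff h).1 ha
  have hsb := (index_eq_some_iff h).1 hi
  have hne : conjugated h i a ≠ conjugated h i b := fun hc =>
    mem_rowSupport.1 hbr (Entry.index_eq_none.2 (h.eq_zero_of_isConj_eq hab ha hi (by
      rw [hra, hsb]; exact hc)))
  have h1 := card_rowSupport_row_le h i a
  have h2 := card_rowSupport_row_le h i b
  rw [← hra] at h1
  rw [← hsb, ← Bool.eq_not.2 hne] at h2
  have h3 := columnCount_add h i (conjugated h i a)
  -- The weights of r and s sum to at least 10, while the two bounds sum to 7 + 2.
  omega

end Design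
/-! ### Training-embedded codes: rates and generation by designs -/

theorem firstPhaseUses_eq {T k : ℕ} (h : k ≤ T) : firstPhaseUses T k = (T - k + 1) / 2 + k := by
  rw [firstPhaseUses, Nat.add_right_cancel_iff]
  obtain ⟨d, rfl⟩ := Nat.exists_eq_add_of_le h
  rw [Nat.add_sub_cancel_left]
  refine eq_of_forall_ge_iff fun c => ?_
  rw [Nat.ceil_le, div_le_iff₀ (by norm_num)]
  have : ((k + d : ℕ) : ℚ) - k = d := by push_cast; ring
  rw [this]
  norm_cast
  omega

namespace TEDSTBC

variable {T K k : ℕ}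

theorem overallRate_eq (C : TEDSTBC T K k) :
    C.overallRate = (k : ℚ) / ((⌈((T : ℚ) - k) / 2⌉ : ℤ) + (k : ℚ) + T) := by
  have h : (0 : ℚ) ≤ ((T : ℚ) - k) / 2 := by
    have : (k : ℚ) ≤ T := by exact_mod_cast C.k_le
    linarith
  rw [overallRate, channelUses, firstPhaseUses, Fintype.card_fin, Fintype.card_fin,
    ← natCast_ceil_eq_intCast_ceil h]
  push_cast
  rfl

theorem overallRate_eq_nat (C : TEDSTBC T K k) :
    C.overallRate = (k : ℚ) / (((T - k + 1) / 2 + k + T : ℕ) : ℚ) := by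
  rw [overallRate, channelUses, Fintype.card_fin, Fintype.card_fin, firstPhaseUses_eq C.k_le]

end TEDSTBC

/-- The vector `[α ⋯ α x₁ ⋯ x_k]` of length `T`. -/
def paddedVector {T k : ℕ} (h : k ≤ T) (α : ℂ) (x : Fin k → ℂ) : Fin T → ℂ := fun t =>
  Fin.append (fun _ : Fin (T - k) => α) x (t.cast (Nat.sub_add_cancel h).symm)

theorem exists_paddedVector_eq {T k : ℕ} (h : k ≤ T) (α : ℂ) (i : Fin k) :
    ∃ t : Fin T, ∀ x, paddedVector h α x t = x i :=
  ⟨(Fin.natAdd (T - k) i).cast (Nat.sub_add_cancel h), fun x => by simp [paddedVector]⟩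

theorem exists_paddedVector_eq_const {T k : ℕ} (h : k < T) (α : ℂ) :
    ∃ t : Fin T, ∀ x, paddedVector h.le α x t = α :=
  ⟨(Fin.castAdd k (⟨0, Nat.sub_pos_of_lt h⟩ : Fin (T - k))).cast (Nat.sub_add_cancel h.le),
    fun x => Fin.append_left (fun _ : Fin (T - k) => α) x ⟨0, Nat.sub_pos_of_lt h⟩⟩

/-- A zero entry becomes α, which is read off a padding coordinate; one exists only if k < T. -/
theorem Entry.exists_dotProduct_eq_eval {T k : ℕ} (h : k ≤ T) (α : ℂ) (e : Entry k)
    (he : e = .zero → k < T) : ∃ a b : Fin T → ℂ, ∀ x,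
      a ⬝ᵥ paddedVector h α x + b ⬝ᵥ star (paddedVector h α x) = e.eval α x := by
  cases e with
  | zero =>
    obtain ⟨t, ht⟩ := exists_paddedVector_eq_const (he rfl) α
    exact ⟨Pi.single t 1, 0, fun x => by simp [ht, Entry.eval]⟩
  | var s i =>
    obtain ⟨t, ht⟩ := exists_paddedVector_eq h α i
    exact ⟨Pi.single t ((s : ℤ) : ℂ), 0, fun x => by simp [ht, Entry.eval]⟩
  | conjVar s i =>
    obtain ⟨t, ht⟩ := exists_paddedVector_eq h α i
    exact ⟨0, Pi.single t ((s : ℤ) : ℂ), fun x => by simp [ht, Entry.eval]⟩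

theorem exists_isGeneratedBy {T K k : ℕ} {X : Design T K k} {α : ℂ} (M : Set ℂ) (h : k ≤ T)
    (hX : ∀ t l, X t l = .zero → k < T) (hα : α ≠ 0) :
    ∃ C : TEDSTBC T K k, C.alpha = α ∧ C.signalSet = M ∧ C.IsGeneratedBy X := by
  choose a b hab using fun t l => (X t l).exists_dotProduct_eq_eval h α (hX t l)
  refine ⟨⟨h, α, hα, M, fun l => Matrix.of fun t => a t l, fun l => Matrix.of fun t => b t l⟩,
    rfl, rfl, fun x => ?_⟩
  ext t l
  exact hab t l x

/-! ### Designs from the subsets of a finite set -/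

section SubsetDesign

variable {n : ℕ}

/-- The sign `(-1)^#{i ∈ S | i < j}`. -/
def subsetSign (S : Finset (Fin n)) (j : Fin n) : ℤˣ :=
  (-1) ^ (S.filter (· < j)).card

/-- Toggling i and j changes the number of elements below j by one and leaves those below i
unchanged. -/
theorem subsetSign_symmDiff_of_lt {i j : Fin n} (h : i < j) (S : Finset (Fin n)) :
    subsetSign (symmDiff S {i, j}) i = subsetSign S i ∧
      subsetSign (symmDiff S {i, j}) j = - subsetSign S j := by
  constructor
  · unfold subsetSign
    congr 2
    ext l
    simp only [Finset.mem_filter, Finset.mem_symmDiff, Finset.mem_insert, Finset.mem_singleton]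
    constructor <;> rintro ⟨h1, h2⟩ <;> grind
  · unfold subsetSign
    by_cases hi : i ∈ S
    · have : S.filter (· < j) = insert i ((symmDiff S {i, j}).filter (· < j)) := by
        ext l
        simp only [Finset.mem_filter, Finset.mem_symmDiff, Finset.mem_insert,
          Finset.mem_singleton]
        grind
      rw [this, Finset.card_insert_of_notMem (by simp [Finset.mem_symmDiff, hi]), pow_succ]
      simp
    · have : (symmDiff S {i, j}).filter (· < j) = insert i (S.filter (· < j)) := by
        ext l
        simp only [Finset.mem_filter, Finset.mem_symmDiff, Finset.mem_insert,
          Finset.mem_singleton]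
        grind
      rw [this, Finset.card_insert_of_notMem (by simp [hi]), pow_succ]
      simp

theorem subsetSign_mul_symmDiff {i j : Fin n} (h : i ≠ j) (S : Finset (Fin n)) :
    subsetSign (symmDiff S {i, j}) i * subsetSign (symmDiff S {i, j}) j =
      - (subsetSign S i * subsetSign S j) := by
  rcases lt_or_gt_of_ne h with h | h
  · obtain ⟨h1, h2⟩ := subsetSign_symmDiff_of_lt h S
    rw [h1, h2, mul_neg]
  · obtain ⟨h1, h2⟩ := subsetSign_symmDiff_of_lt h S
    rw [Finset.pair_comm, h1, h2, neg_mul]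

/-- The value at row `S` and column `j`, where the variables are indexed by sets. -/
noncomputable def subsetValue (y : Finset (Fin n) → ℂ) (S : Finset (Fin n)) (j : Fin n) : ℂ :=
  ((subsetSign S j : ℤ) : ℂ) *
    if j ∈ S then star (y (symmDiff S {j})) else y (symmDiff S {j})

theorem sum_star_subsetValue_mul_self (y : Finset (Fin n) → ℂ) (j : Fin n) :
    ∑ S, star (subsetValue y S j) * subsetValue y S j = ∑ U, ((‖y U‖ ^ 2 : ℝ) : ℂ) := by
  refine Fintype.sum_bijective (fun S => symmDiff S {j})
    (Function.Involutive.bijective fun S => symmDiff_symmDiff_cancel_right _ _) _ _ fun S => ?_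
  have key : ∀ z : ℂ, star z * z = ((‖z‖ ^ 2 : ℝ) : ℂ) := fun z => by
    simpa using Complex.conj_mul' z
  rw [key, subsetValue, norm_mul]
  rcases Int.units_eq_one_or (subsetSign S j) with h | h <;> rw [h] <;> split_ifs <;> simp

theorem card_symmDiff_singleton_of_mem {S : Finset (Fin n)} {j : Fin n} (h : j ∈ S) :
    (symmDiff S {j}).card + 1 = S.card := by
  have : symmDiff S {j} = S.erase j := by
    ext l
    simp only [Finset.mem_symmDiff, Finset.mem_singleton, Finset.mem_erase]
    grind
  rw [this, Finset.card_erase_add_one h]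

theorem card_symmDiff_singleton_of_notMem {S : Finset (Fin n)} {j : Fin n} (h : j ∉ S) :
    (symmDiff S {j}).card = S.card + 1 := by
  have : symmDiff S {j} = insert j S := by
    ext l
    simp only [Finset.mem_symmDiff, Finset.mem_singleton, Finset.mem_insert]
    grind
  rw [this, Finset.card_insert_of_notMem h]

/-- The involution S ↦ S ∆ {i, j} swaps the two variables and flips both conjugations, while the
sign product changes sign. -/
theorem sum_star_subsetValue_mul {p : ℕ} {y : Finset (Fin n) → ℂ}
    (hy : ∀ U, U.card ≠ p → y U = 0) {i j : Fin n} (hij : i ≠ j) :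
    ∑ S, star (subsetValue y S i) * subsetValue y S j = 0 := by
  refine Finset.sum_involution (fun S _ => symmDiff S {i, j}) ?_ ?_ (fun _ _ => Finset.mem_univ _)
    (fun S _ => symmDiff_symmDiff_cancel_right _ _)
  · intro S _
    have e1 : symmDiff (symmDiff S {i, j}) {i} = symmDiff S {j} := by
      ext l
      simp only [Finset.mem_symmDiff, Finset.mem_singleton, Finset.mem_insert]
      grind
    have e2 : symmDiff (symmDiff S {i, j}) {j} = symmDiff S {i} := by
      ext l
      simp only [Finset.mem_symmDiff, Finset.mem_singleton, Finset.mem_insert]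
      grind
    have m1 : i ∈ symmDiff S {i, j} ↔ i ∉ S := by simp [Finset.mem_symmDiff]
    have m2 : j ∈ symmDiff S {i, j} ↔ j ∉ S := by simp [Finset.mem_symmDiff]
    have hs := congrArg (fun u : ℤˣ => ((u : ℤ) : ℂ)) (subsetSign_mul_symmDiff hij S)
    simp only [Units.val_mul, Units.val_neg, Int.cast_mul, Int.cast_neg] at hs
    -- If exactly one of i, j lies in S, the sets S ∆ {i} and S ∆ {j} differ in size by two, so they
    -- cannot both have size p.
    have hz : (i ∈ S ↔ j ∉ S) → y (symmDiff S {i}) = 0 ∨ y (symmDiff S {j}) = 0 := by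
      intro hS
      by_contra! hcon
      have c1 := not_imp_comm.1 (hy _) hcon.1
      have c2 := not_imp_comm.1 (hy _) hcon.2
      by_cases hi : i ∈ S
      · have := card_symmDiff_singleton_of_mem hi
        have := card_symmDiff_singleton_of_notMem (hS.1 hi)
        omega
      · have := card_symmDiff_singleton_of_notMem hi
        have := card_symmDiff_singleton_of_mem (not_not.1 (mt hS.2 hi))
        omega
    simp only [subsetValue, e1, e2, m1, m2, star_mul', star_intCast]
    by_cases hi : i ∈ S <;> by_cases hj : j ∈ S <;>
      simp only [hi, hj, if_true, if_false, not_true, not_false_iff, star_star]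
    · linear_combination (y (symmDiff S {i}) * star (y (symmDiff S {j}))) * hs
    · rcases hz (by simp [hi, hj]) with h | h <;> simp [h]
    · rcases hz (by simp [hi, hj]) with h | h <;> simp [h]
    · linear_combination (star (y (symmDiff S {i})) * y (symmDiff S {j})) * hs
  · intro S _ _ hS
    have : i ∈ symmDiff S {i, j} ↔ i ∉ S := by simp [Finset.mem_symmDiff]
    rw [hS] at this
    tauto

/-- The entry at row `S` and column `j` of the design whose variables are the sets of cardinality
`p`, enumerated by `e`. -/
noncomputable def subsetEntry {p k : ℕ} (e : {U : Finset (Fin n) // U.card = p} ≃ Fin k)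
    (S : Finset (Fin n)) (j : Fin n) : Entry k :=
  if h : (symmDiff S {j}).card = p then
    if j ∈ S then .conjVar (subsetSign S j) (e ⟨_, h⟩) else .var (subsetSign S j) (e ⟨_, h⟩)
  else .zero

theorem eval_subsetEntry {p k : ℕ} (e : {U : Finset (Fin n) // U.card = p} ≃ Fin k)
    (S : Finset (Fin n)) (j : Fin n) (x : Fin k → ℂ) :
    (subsetEntry e S j).eval 0 x =
      subsetValue (fun U => if h : U.card = p then x (e ⟨U, h⟩) else 0) S j := by
  unfold subsetEntry subsetValue
  by_cases h : (symmDiff S {j}).card = p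
  · simp only [dif_pos h]
    split_ifs <;> rfl
  · simp [h, Entry.eval]

theorem card_subsetRows (n q : ℕ) :
    Fintype.card {S : Finset (Fin n) // S.card = q ∨ S.card = q + 2} =
      n.choose q + n.choose (q + 2) := by
  rw [Fintype.card_subtype, Finset.filter_or, Finset.card_union_of_disjoint]
  · rw [Finset.univ_filter_card_eq, Finset.univ_filter_card_eq, Finset.card_powersetCard,
      Finset.card_powersetCard, Finset.card_univ, Fintype.card_fin]
  · rw [Finset.disjoint_filter]
    omega

theorem exists_subsetDesign {n q T k : ℕ} (hT : T = n.choose q + n.choose (q + 2))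
    (hk : k = n.choose (q + 1)) : ∃ X : Design T n k, X.IsCOD := by
  let e : {U : Finset (Fin n) // U.card = q + 1} ≃ Fin k :=
    Fintype.equivFinOfCardEq (by rw [Fintype.card_finset_len, Fintype.card_fin, hk])
  let f : {S : Finset (Fin n) // S.card = q ∨ S.card = q + 2} ≃ Fin T :=
    Fintype.equivFinOfCardEq (by rw [card_subsetRows, hT])
  refine ⟨Matrix.of fun t j => subsetEntry e (f.symm t).1 j, Design.isCOD_iff.2 fun x a b => ?_⟩
  let y : Finset (Fin n) → ℂ := fun U => if h : U.card = q + 1 then x (e ⟨U, h⟩) else 0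
  have hy : ∀ U, U.card ≠ q + 1 → y U = 0 := fun U hU => dif_neg hU
  have h1 : ∑ t, star ((subsetEntry e (f.symm t).1 a).eval 0 x) *
      (subsetEntry e (f.symm t).1 b).eval 0 x =
      ∑ S, star (subsetValue y S a) * subsetValue y S b := by
    simp only [eval_subsetEntry]
    rw [Equiv.sum_comp f.symm (fun S => star (subsetValue y S.1 a) * subsetValue y S.1 b),
      ← Finset.sum_subtype (Finset.univ.filter fun S : Finset (Fin n) =>
        S.card = q ∨ S.card = q + 2) (by simp)
        (fun S => star (subsetValue y S a) * subsetValue y S b)]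
    refine Finset.sum_subset (Finset.subset_univ _) fun S _ hS => ?_
    -- Rows of any other size contain no variable, so the sum may run over all subsets.
    have : subsetValue y S a = 0 := by
      have : y (symmDiff S {a}) = 0 := hy _ fun h => hS (by
        rw [Finset.mem_filter]
        by_cases ha : a ∈ S
        · have := card_symmDiff_singleton_of_mem ha
          exact ⟨Finset.mem_univ _, by omega⟩
        · have := card_symmDiff_singleton_of_notMem ha
          exact ⟨Finset.mem_univ _, by omega⟩)
      simp [subsetValue, this]
    simp [this]
  refine h1.trans ?_
  split_ifs with hab
  · subst hab
    rw [sum_star_subsetValue_mul_self, ← Complex.ofReal_sum]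
    congr 1
    rw [← Equiv.sum_comp e, ← Finset.sum_subset (Finset.subset_univ
      (Finset.univ.filter fun U : Finset (Fin n) => U.card = q + 1))]
    · rw [Finset.sum_subtype (p := fun U : Finset (Fin n) => U.card = q + 1) _ (by simp)]
      refine Finset.sum_congr rfl fun U _ => ?_
      simp [y, U.2]
    · intro U _ hU
      rw [hy U (by simpa using hU)]
      simp
  · exact sum_star_subsetValue_mul hy hab

end SubsetDesign

/-- A `4 × 4` design in three variables. -/
def designFour : Design 4 4 3 :=
  !![.var 1 0, .var 1 1, .var 1 2, .zero;
    .conjVar (-1) 1, .conjVar 1 0, .zero, .var 1 2;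
    .conjVar (-1) 2, .zero, .conjVar 1 0, .var (-1) 1;
    .zero, .conjVar (-1) 2, .conjVar 1 1, .var 1 0]

theorem designFour_isCOD : designFour.IsCOD := by
  rw [Design.isCOD_iff]
  intro x a b
  have key : ∀ z : ℂ, (‖z‖ : ℂ) ^ 2 = (starRingEnd ℂ) z * z := fun z =>
    (Complex.conj_mul' z).symm
  fin_cases a <;> fin_cases b <;>
    simp [designFour, Fin.sum_univ_four, Fin.sum_univ_three, Entry.eval, key] <;> ring

/-! ### Maximal-rate complex orthogonal designs -/

/-- The ratios of consecutive binomial coefficients show that the subset design attains the rate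
bound. -/
theorem two_mul_mul_choose (m : ℕ) (hm : 1 ≤ m) {n : ℕ} (hn : n = 2 * m ∨ n = 2 * m - 1) :
    2 * m * n.choose m = (m + 1) * (n.choose (m - 1) + n.choose (m + 1)) := by
  obtain ⟨q, rfl⟩ := Nat.exists_eq_add_of_le' hm
  rw [Nat.add_sub_cancel]
  have h1 := Nat.choose_succ_right_eq n (q + 1)
  have h2 := Nat.choose_succ_right_eq n q
  rcases hn with rfl | rfl
  · rw [show 2 * (q + 1) - (q + 1) = q + 1 by omega] at h1
    rw [show 2 * (q + 1) - q = q + 2 by omega] at h2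
    linarith
  · rw [show 2 * (q + 1) - 1 - (q + 1) = q by omega] at h1
    rw [show 2 * (q + 1) - 1 - q = q + 1 by omega] at h2
    have h3 := Nat.eq_of_mul_eq_mul_right (Nat.succ_pos q) h2
    rw [← h3]
    linarith

namespace Design

variable {T K k m : ℕ}

theorem IsCOD.rate_le {X : Design T K k} (h : X.IsCOD) (hm : 1 ≤ m)
    (hK : K = 2 * m ∨ K = 2 * m - 1) : (k : ℚ) / T ≤ (m + 1) / (2 * m) := by
  rcases Nat.eq_zero_or_pos T with rfl | hT
  · simp only [Nat.cast_zero, div_zero]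
    positivity
  rw [div_le_div_iff₀ (by exact_mod_cast hT) (by positivity)]
  have := h.rate_bound hm hK
  rw [mul_comm (k : ℚ)]
  exact_mod_cast this

theorem IsCOD.isMaximalRateCOD {X : Design T K k} (h : X.IsCOD) (hm : 1 ≤ m)
    (hK : K = 2 * m ∨ K = 2 * m - 1) (hT : 1 ≤ T) (hk : 2 * m * k = (m + 1) * T) :
    X.IsMaximalRateCOD := by
  refine ⟨h, fun T' k' Y hY => (hY.rate_le hm hK).trans_eq ?_⟩
  rw [div_eq_div_iff (by positivity) (by positivity)]
  have : (2 * m * k : ℚ) = (m + 1) * T := by exact_mod_cast hk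
  linarith

theorem exists_isMaximalRateCOD (hm : 1 ≤ m) (hK : K = 2 * m ∨ K = 2 * m - 1)
    (hT : T = K.choose (m - 1) + K.choose (m + 1)) (hk : k = K.choose m) :
    ∃ X : Design T K k, X.IsMaximalRateCOD := by
  obtain ⟨X, hX⟩ := exists_subsetDesign (n := K) (T := T) (k := k) (q := m - 1)
    (by rw [hT, show m - 1 + 2 = m + 1 by omega]) (by rw [hk, Nat.sub_add_cancel hm])
  refine ⟨X, hX.isMaximalRateCOD hm hK ?_ ?_⟩
  · have : 0 < K.choose (m - 1) := Nat.choose_pos (by omega)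
    omega
  · rw [hk, hT, two_mul_mul_choose m hm hK]

/-- Comparison with the subset design gives equality in the rate bound. It also makes the rate
positive, which excludes T = 0, where the quotient is 0 by convention. -/
theorem IsMaximalRateCOD.pos_and_eq {X : Design T K k} (h : X.IsMaximalRateCOD) (hm : 1 ≤ m)
    (hK : K = 2 * m ∨ K = 2 * m - 1) : 0 < T ∧ 0 < k ∧ 2 * m * k = (m + 1) * T := by
  obtain ⟨Y, hY⟩ := exists_isMaximalRateCOD hm hK rfl rfl
  have h1 := h.2 _ _ Y hY.1
  have hpos : 0 < K.choose m := Nat.choose_pos (by omega)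
  have hTY : 0 < K.choose (m - 1) + K.choose (m + 1) :=
    Nat.add_pos_left (Nat.choose_pos (by omega)) _
  have h2 : (0 : ℚ) < k / T := lt_of_lt_of_le (by positivity) h1
  have hT : 0 < T := by
    refine Nat.pos_of_ne_zero fun h0 => ?_
    simp [h0] at h2
  have hk : 0 < k := by
    refine Nat.pos_of_ne_zero fun h0 => ?_
    simp [h0] at h2
  refine ⟨hT, hk, le_antisymm (h.1.rate_bound hm hK) ?_⟩
  rw [div_le_div_iff₀ (by exact_mod_cast hTY) (by exact_mod_cast hT)] at h1
  norm_cast at h1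
  refine le_of_mul_le_mul_right ?_ hTY
  calc (m + 1) * T * (K.choose (m - 1) + K.choose (m + 1))
      = 2 * m * (K.choose m * T) := by
        rw [mul_right_comm, ← two_mul_mul_choose m hm hK, mul_assoc]
    _ ≤ 2 * m * (k * (K.choose (m - 1) + K.choose (m + 1))) := Nat.mul_le_mul_left _ h1
    _ = _ := by ring

/-- If k = T, the injection of variables into the rows of column a is onto, leaving no room for a
zero. -/
theorem IsCOD.variables_lt_of_eq_zero {X : Design T K k} (h : X.IsCOD) {t : Fin T} {a : Fin K}
    (ht : X t a = .zero) : k < T := by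
  refine lt_of_le_of_ne (h.card_variables_le (Fin.pos a)) fun hkT => ?_
  have hs := ((Fintype.bijective_iff_injective_and_card _).2
    ⟨row_injective h a, by simpa using hkT⟩).2 t
  obtain ⟨i, rfl⟩ := hs
  have := index_row h i a
  rw [ht] at this
  simp [Entry.index] at this

theorem IsCOD.not_eight_five (X : Design 8 K 5) (hK : 7 ≤ K) : ¬ X.IsCOD := fun h =>
  not_isCOD_of_seven_columns _ (h.submatrix (Fin.castLE_injective hK))

end Design

theorem tableEntry_of_exists {T K k : ℕ} {r : ℚ} (h : ∃ X : Design T K k, X.IsMaximalRateCOD)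
    (hr : (k : ℚ) / (((T - k + 1) / 2 + k + T : ℕ) : ℚ) = r) : TableEntry K T k r :=
  ⟨h, fun _ C _ _ => C.overallRate_eq_nat.trans hr⟩

theorem overallRate_eq_closedForm {m T K k : ℕ} {X : Design T K k} (C : TEDSTBC T K k)
    (hm : 1 ≤ m) (hK : K = 2 * m ∨ K = 2 * m - 1) (hX : X.IsMaximalRateCOD) :
    C.overallRate = ((T : ℚ) * (m + 1) / (2 * m)) /
      ((T : ℚ) * (m + 1) / (2 * m) + T + (⌈(T : ℚ) * (1 / 4 - 1 / (4 * m))⌉ : ℤ)) := by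
  obtain ⟨-, -, h⟩ := hX.pos_and_eq hm hK
  have hm0 : (m : ℚ) ≠ 0 := by positivity
  have hk : (T : ℚ) * (m + 1) / (2 * m) = k := by
    rw [div_eq_iff (by positivity)]
    have : (2 * m * k : ℚ) = (m + 1) * T := by exact_mod_cast h
    linarith
  have hc : (T : ℚ) * (1 / 4 - 1 / (4 * m)) = (T - k) / 2 := by
    rw [← hk]
    field_simp
    ring
  rw [C.overallRate_eq, hk, hc]
  congr 1
  ring

/-! ### Comparison of the overall rate with 1/3 -/

section Comparison

variable {T K k : ℕ} {X : Design T K k}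

theorem one_third_lt_overallRate (C : TEDSTBC T K k) (hX : X.IsMaximalRateCOD) (hK : 1 ≤ K)
    (hK9 : K < 9) : 1 / 3 < C.overallRate := by
  obtain ⟨m, hm, hKm⟩ : ∃ m, 1 ≤ m ∧ (K = 2 * m ∨ K = 2 * m - 1) := ⟨(K + 1) / 2, by omega⟩
  obtain ⟨hT, hk, h⟩ := hX.pos_and_eq hm hKm
  -- For m = 3 this excludes (T, k) = (3, 2), where rounding up would give exactly 1/3.
  have hTK := hX.1.columns_le hk
  have hk_le := C.k_le
  rw [C.overallRate_eq_nat, div_lt_div_iff₀ (by norm_num) (by positivity)]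
  -- For m = 4, T = 8s and k = 5s, so the inequality is ⌈3s/2⌉ < 2s, which fails for positive s only
  -- at s = 1.
  have h85 : ¬ (T = 8 ∧ k = 5 ∧ 7 ≤ K) := by
    rintro ⟨rfl, rfl, h7⟩
    exact Design.IsCOD.not_eight_five X h7 hX.1
  norm_cast
  have hm4 : m ≤ 4 := by omega
  interval_cases m <;> omega

theorem overallRate_eq_one_third (C : TEDSTBC T K k) (hX : X.IsMaximalRateCOD)
    (hK : K = 9 ∨ K = 10) : C.overallRate = 1 / 3 := by
  obtain ⟨hT, hk, h⟩ := hX.pos_and_eq (m := 5) (by norm_num) (by omega)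
  have hk_le := C.k_le
  rw [C.overallRate_eq_nat, div_eq_div_iff (by positivity) (by norm_num)]
  norm_cast
  -- Here T = 5s and k = 3s, so T - k is even and the total is 9s.
  omega

theorem overallRate_lt_one_third (C : TEDSTBC T K k) (hX : X.IsMaximalRateCOD) (hK : 11 ≤ K) :
    C.overallRate < 1 / 3 := by
  obtain ⟨m, hm, hKm⟩ : ∃ m, 1 ≤ m ∧ (K = 2 * m ∨ K = 2 * m - 1) := ⟨(K + 1) / 2, by omega⟩
  obtain ⟨hT, hk, h⟩ := hX.pos_and_eq hm hKm
  have hk_le := C.k_le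
  rw [C.overallRate_eq_nat, div_lt_div_iff₀ (by positivity) (by norm_num)]
  norm_cast
  have hm6 : 6 ≤ m := by omega
  -- (m + 1)/(2m) drops below 3/5 exactly when m ≥ 6; rounding up only lowers the overall rate
  -- further.
  have h5 : 5 * k < 3 * T := by
    refine lt_of_mul_lt_mul_left (a := 2 * m) ?_ (by positivity)
    nlinarith
  omega

end Comparison

theorem overallRateWithoutTraining_eq_one_third {T k : ℕ} (h : (k : ℚ) / T = 1 / 2) :
    overallRateWithoutTraining T k = 1 / 3 := by
  have hT : (T : ℚ) ≠ 0 := by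
    rintro h0
    norm_num [h0] at h
  have hk : (T : ℚ) = 2 * k := by
    rw [div_eq_div_iff hT (by norm_num)] at h
    linarith
  have hk0 : (k : ℚ) ≠ 0 := by
    rintro h0
    simp [hk, h0] at hT
  rw [overallRateWithoutTraining, hk]
  field_simp
  norm_num

end TECOD

theorem mainTheorem4 :
    -- the overall rate of an arbitrary TE-DSTBC
    (∀ (T K k : ℕ) (C : TECOD.TEDSTBC T K k),
      C.overallRate = (k : ℚ) / ((⌈((T : ℚ) - k) / 2⌉ : ℤ) + (k : ℚ) + T)) ∧
    -- every COD generates a TE-DSTBC, for every training symbol and signal set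
    (∀ (T K k : ℕ) (X : TECOD.Design T K k) (α : ℂ) (M : Set ℂ), 1 ≤ K → X.IsCOD → α ≠ 0 →
      ∃ C : TECOD.TEDSTBC T K k, C.alpha = α ∧ C.signalSet = M ∧ C.IsGeneratedBy X) ∧
    -- maximal-rate CODs exist for every number of relays
    (∀ K : ℕ, 1 ≤ K → ∃ (T k : ℕ) (X : TECOD.Design T K k), X.IsMaximalRateCOD) ∧
    -- the closed form for maximal-rate CODs and `2m` or `2m - 1` relays
    (∀ (m T K k : ℕ) (X : TECOD.Design T K k) (C : TECOD.TEDSTBC T K k),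
      1 ≤ m → (K = 2 * m ∨ K = 2 * m - 1) → X.IsMaximalRateCOD → C.IsGeneratedBy X →
      C.overallRate = ((T : ℚ) * (m + 1) / (2 * m)) /
        ((T : ℚ) * (m + 1) / (2 * m) + T + (⌈(T : ℚ) * (1 / 4 - 1 / (4 * m))⌉ : ℤ))) ∧
    -- the table of rates
    (TECOD.TableEntry 4 4 3 (3 / 8) ∧
      TECOD.TableEntry 5 15 10 (5 / 14) ∧
      TECOD.TableEntry 6 30 20 (4 / 11) ∧
      TECOD.TableEntry 7 56 35 (35 / 102) ∧
      TECOD.TableEntry 8 112 70 (70 / 203) ∧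
      TECOD.TableEntry 9 210 126 (126 / 378) ∧
      TECOD.TableEntry 10 420 252 (252 / 756)) ∧
    -- the overall rate of the earlier codes, of rate `1/2` in the second phase
    (∀ T k : ℕ, (k : ℚ) / T = 1 / 2 → TECOD.overallRateWithoutTraining T k = 1 / 3) ∧
    -- the comparison of the rates for maximal-rate CODs with `1/3`
    (∀ (T K k : ℕ) (X : TECOD.Design T K k) (C : TECOD.TEDSTBC T K k),
      1 ≤ K → X.IsMaximalRateCOD → C.IsGeneratedBy X →
      (1 / 3 < C.overallRate ↔ K < 9) ∧
      (C.overallRate = 1 / 3 ↔ K = 9 ∨ K = 10) ∧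
      (C.overallRate < 1 / 3 ↔ 11 ≤ K)) := by
  refine ⟨fun T K k C => C.overallRate_eq, fun T K k X α M hK hX hα =>
      TECOD.exists_isGeneratedBy M (hX.card_variables_le hK)
        (fun _ _ h => hX.variables_lt_of_eq_zero h) hα,
    fun K hK => ⟨_, _, TECOD.Design.exists_isMaximalRateCOD (m := (K + 1) / 2)
      (by omega) (by omega) rfl rfl⟩,
    fun m T K k X C hm hK hX _ => TECOD.overallRate_eq_closedForm C hm hK hX,
    ⟨?_, ?_, ?_, ?_, ?_, ?_, ?_⟩,
    fun T k h => TECOD.overallRateWithoutTraining_eq_one_third h,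
    fun T K k X C hK hX _ => ?_⟩
  -- For K = 4 the subset design has (T, k) = (8, 6), so the smaller parameters need an explicit
  -- matrix.
  · exact TECOD.tableEntry_of_exists ⟨_, TECOD.designFour_isCOD.isMaximalRateCOD (m := 2)
      (by norm_num) (by norm_num) (by norm_num) (by norm_num)⟩ (by norm_num)
  · exact TECOD.tableEntry_of_exists (TECOD.Design.exists_isMaximalRateCOD (m := 3)
      (by norm_num) (by norm_num) (by decide) (by decide)) (by norm_num)
  · exact TECOD.tableEntry_of_exists (TECOD.Design.exists_isMaximalRateCOD (m := 3)
      (by norm_num) (by norm_num) (by decide) (by decide)) (by norm_num)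
  · exact TECOD.tableEntry_of_exists (TECOD.Design.exists_isMaximalRateCOD (m := 4)
      (by norm_num) (by norm_num) (by decide) (by decide)) (by norm_num)
  · exact TECOD.tableEntry_of_exists (TECOD.Design.exists_isMaximalRateCOD (m := 4)
      (by norm_num) (by norm_num) (by decide) (by decide)) (by norm_num)
  · exact TECOD.tableEntry_of_exists (TECOD.Design.exists_isMaximalRateCOD (m := 5)
      (by norm_num) (by norm_num) (by decide) (by decide)) (by norm_num)
  · exact TECOD.tableEntry_of_exists (TECOD.Design.exists_isMaximalRateCOD (m := 5)
      (by norm_num) (by norm_num) (by decide) (by decide)) (by norm_num)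
  · have h1 := TECOD.one_third_lt_overallRate C hX hK
    have h2 := TECOD.overallRate_eq_one_third C hX
    have h3 := TECOD.overallRate_lt_one_third C hX
    rcases lt_or_ge K 9 with h | h
    · have := h1 h
      exact ⟨iff_of_true this h, iff_of_false this.ne' (by omega),
        iff_of_false this.not_gt (by omega)⟩
    · rcases lt_or_ge K 11 with h' | h'
      · have := h2 (by omega)
        exact ⟨iff_of_false this.not_gt (by omega), iff_of_true this (by omega),
          iff_of_false this.not_lt (by omega)⟩
      · have := h3 h'
        exact ⟨iff_of_false this.not_gt (by omega), iff_of_false this.ne (by omega),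
          iff_of_true this h'⟩
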